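/- Let $J:\mathbb{R}^p\to\mathbb{R}$ be a finite-valued convex function. For $\theta=(\mu,u,\Gamma)$ with $\mu>0$, $u\in\mathbb{R}^p$ and $\Gamma\in\mathbb{R}^{p\times p}$ symmetric positive semidefinite (as for $\Gamma=X^*X/n$), consider the problem $$(\mathcal{P}_\theta)\qquad \min_{\beta\in\mathbb{R}^p}\; E(\beta,\theta)=J(\beta)+\frac{1}{2\mu}\langle\Gamma\beta,\beta\rangle-\frac1\mu\langle\beta,u\rangle+\frac{1}{2\mu}\langle\Gamma^+u,u\rangle ,$$ where $\Gamma^+$ is the Moore–Penrose pseudo-inverse of $\Gamma$. Let $\partial J(\beta)$ be the convex subdifferential, let $T_\beta$ be the orthogonal complement of the linear span of $\partial J(\beta)-\partial J(\beta)$, and let $\mathrm{ri}$ denote the relative interior. $J$ is called partly smooth at $\beta$ relative to a set $\mathcal{M}\ni\beta$ if (i) $\mathcal{M}$ is a $C^2$-manifold around $\beta$ (embedded in $\mathbb{R}^p$) and $J$ restricted to $\mathcal{M}$ is $C^2$ around $\beta$; (ii) the tangent space of $\mathcal{M}$ at $\beta$ is $T_\beta$; (iii) the set-valued map $\partial J$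 is continuous at $\beta$ relative to $\mathcal{M}$. $J$ is called locally partly smooth at $\beta$ relative to $\mathcal{M}\ni\beta$ if $\mathcal{M}$ is a $C^2$-manifold and there is a neighbourhood $U$ of $\beta$ such that $J$ is partly smooth at each point of $\mathcal{M}\cap U$ relative to $\mathcal{M}$. **Theorem 4.** Let $\theta=(\mu,u,\Gamma)$ be as above and let $\beta_\theta$ be a solution of $(\mathcal{P}_\theta)$. Assume that $J$ is locally partly smooth at $\beta_\theta$ relative to $\mathcal{M}$ and that $$\ker(\Gamma)\cap T_{\beta_\theta}=\{0\}\quad\text{and}\quad \frac{u-\Gamma\beta_\theta}{\mu}\in\mathrm{ri}(\partial J(\beta_\theta)).$$ Then for all $\theta'=(\mu',u',\Gamma')$ sufficiently close to $\theta$, with $\mu'>0$ and $\Gamma'$ symmetric positive semidefinite, the problem $(\mathcal{P}_{\theta'})$ has exactly one solution $\beta_{\theta'}$, and $\beta_{\theta'}\in\mathcal{M}$. -/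

import Mathlib

open Set Filter Topology
open scoped InnerProductSpace

/-- A canonical parameter `θ = (μ, u, Γ) ∈ ℝ × ℝ^p × ℝ^{p × p}`, with its product topology. -/
abbrev Param (p : ℕ) : Type :=
  ℝ × EuclideanSpace ℝ (Fin p) × Matrix (Fin p) (Fin p) ℝ

/-- The parameters of the penalized problems: `μ > 0` and `Γ` symmetric positive semidefinite
(equivalently, `Γ = Xᵀ X / n` for some `n ≥ 1` and some design matrix `X ∈ ℝ^{n × p}`). -/
def penalizedParams (p : ℕ) : Set (Param p) :=
  {θ | 0 < θ.1 ∧ θ.2.2.PosSemidef}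

/-- The Moore-Penrose pseudo-inverse of a symmetric real matrix: every nonzero eigenvalue is
inverted (and the eigenvalue `0` is kept, because `(0 : ℝ)⁻¹ = 0`). -/
noncomputable def symmPinv {p : ℕ} (A : Matrix (Fin p) (Fin p) ℝ) : Matrix (Fin p) (Fin p) ℝ :=
  cfc (fun x : ℝ => x⁻¹) A

/-- The four Penrose equations, which characterize the Moore-Penrose pseudo-inverse. -/
theorem symmPinv_spec {p : ℕ} {A : Matrix (Fin p) (Fin p) ℝ} (hA : A.IsHermitian) :
    A * symmPinv A * A = A ∧ symmPinv A * A * symmPinv A = symmPinv A ∧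
      (A * symmPinv A).IsHermitian ∧ (symmPinv A * A).IsHermitian := by
  have hc : ∀ f : ℝ → ℝ, ContinuousOn f (spectrum ℝ A) := fun f =>
    (Matrix.finite_real_spectrum (A := A)).continuousOn f
  have hA' : IsSelfAdjoint A := hA
  have hid : cfc (fun x : ℝ => x) A = A := cfc_id' ℝ A
  have h1 : A * symmPinv A = cfc (fun x : ℝ => x * x⁻¹) A := by
    rw [cfc_mul (fun x : ℝ => x) (fun x : ℝ => x⁻¹) A (hc _) (hc _), hid, symmPinv]
  have h2 : symmPinv A * A = cfc (fun x : ℝ => x⁻¹ * x) A := by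
    rw [cfc_mul (fun x : ℝ => x⁻¹) (fun x : ℝ => x) A (hc _) (hc _), hid, symmPinv]
  refine ⟨?_, ?_, ?_, ?_⟩
  · have h3 := cfc_mul (fun x : ℝ => x * x⁻¹) (fun x : ℝ => x) A (hc _) (hc _)
    rw [hid, ← h1] at h3
    have h4 : (fun x : ℝ => x * x⁻¹ * x) = fun x => x := by
      funext x
      by_cases hx : x = 0 <;> simp [hx]
    rw [← h3, h4, hid]
  · have h3 := cfc_mul (fun x : ℝ => x⁻¹ * x) (fun x : ℝ => x⁻¹) A (hc _) (hc _)
    rw [← h2] at h3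
    have h4 : (fun x : ℝ => x⁻¹ * x * x⁻¹) = fun x => x⁻¹ := by
      funext x
      by_cases hx : x = 0 <;> simp [hx]
    rw [h4] at h3
    exact h3.symm
  · rw [h1]
    exact cfc_predicate (p := IsSelfAdjoint) (fun x : ℝ => x * x⁻¹) A
  · rw [h2]
    exact cfc_predicate (p := IsSelfAdjoint) (fun x : ℝ => x⁻¹ * x) A

/-- The objective
`E(β, θ) = J(β) + ⟨Γ β, β⟩ / (2 μ) - ⟨β, u⟩ / μ + ⟨Γ⁺ u, u⟩ / (2 μ)`, for `θ = (μ, u, Γ)`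
with `μ > 0`. -/
noncomputable def objective {p : ℕ} (J : EuclideanSpace ℝ (Fin p) → ℝ) (θ : Param p)
    (β : EuclideanSpace ℝ (Fin p)) : ℝ :=
  J β + 1 / (2 * θ.1) * ⟪Matrix.toEuclideanLin θ.2.2 β, β⟫_ℝ - 1 / θ.1 * ⟪β, θ.2.1⟫_ℝ
    + 1 / (2 * θ.1) * ⟪Matrix.toEuclideanLin (symmPinv θ.2.2) θ.2.1, θ.2.1⟫_ℝ

/-- `β` is a solution (global minimizer) of the penalized problem with parameter `θ`. -/
def IsSolution {p : ℕ} (J : EuclideanSpace ℝ (Fin p) → ℝ) (θ : Param p)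
    (β : EuclideanSpace ℝ (Fin p)) : Prop :=
  ∀ β' : EuclideanSpace ℝ (Fin p), objective J θ β ≤ objective J θ β'

/-- The convex subdifferential `∂J(β)`. -/
def subdiff {p : ℕ} (J : EuclideanSpace ℝ (Fin p) → ℝ) (β : EuclideanSpace ℝ (Fin p)) :
    Set (EuclideanSpace ℝ (Fin p)) :=
  {η | ∀ β' : EuclideanSpace ℝ (Fin p), J β + ⟪η, β' - β⟫_ℝ ≤ J β'}

/-- The tangent model subspace `T_β`: the orthogonal complement of the linear hull of the
differences of elements of `∂J(β)`. -/
noncomputable def modelSubspace {p : ℕ} (J : EuclideanSpace ℝ (Fin p) → ℝ)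
    (β : EuclideanSpace ℝ (Fin p)) : Submodule ℝ (EuclideanSpace ℝ (Fin p)) :=
  (vectorSpan ℝ (subdiff J β))ᗮ

/-- `M` is a `C²` (embedded) manifold around its point `x`: near `x`, it is the zero set of a `C²`
map whose derivative at `x` is surjective. -/
def IsC2ManifoldAround {p : ℕ} (M : Set (EuclideanSpace ℝ (Fin p)))
    (x : EuclideanSpace ℝ (Fin p)) : Prop :=
  x ∈ M ∧ ∃ (m : ℕ) (F : EuclideanSpace ℝ (Fin p) → EuclideanSpace ℝ (Fin m)),
    ContDiffAt ℝ 2 F x ∧ Function.Surjective (fderiv ℝ F x) ∧ ∀ᶠ y in 𝓝 x, (y ∈ M ↔ F y = 0)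

/-- The tangent space of a manifold `M` at `x`: the velocities at `x` of the curves in `M`
through `x`. -/
def tangentVectors {p : ℕ} (M : Set (EuclideanSpace ℝ (Fin p)))
    (x : EuclideanSpace ℝ (Fin p)) : Set (EuclideanSpace ℝ (Fin p)) :=
  {v | ∃ γ : ℝ → EuclideanSpace ℝ (Fin p),
    γ 0 = x ∧ (∀ᶠ t in 𝓝 (0 : ℝ), γ t ∈ M) ∧ HasDerivAt γ v 0}

/-- The restriction of `J` to the manifold `M` is `C²` around `x`: near `x`, it coincides on `M`
with a `C²` function on the ambient space. -/
def IsC2AlongAt {p : ℕ} (J : EuclideanSpace ℝ (Fin p) → ℝ)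
    (M : Set (EuclideanSpace ℝ (Fin p))) (x : EuclideanSpace ℝ (Fin p)) : Prop :=
  ∃ g : EuclideanSpace ℝ (Fin p) → ℝ, ContDiffAt ℝ 2 g x ∧ ∀ᶠ y in 𝓝[M] x, g y = J y

/-- The finite-valued convex function `J` is partly smooth at `x` relative to `M`. -/
structure IsPartlySmoothAt {p : ℕ} (J : EuclideanSpace ℝ (Fin p) → ℝ)
    (M : Set (EuclideanSpace ℝ (Fin p))) (x : EuclideanSpace ℝ (Fin p)) : Prop where
  manifold : IsC2ManifoldAround M x
  smooth : IsC2AlongAt J M x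
  sharp : tangentVectors M x = (modelSubspace J x : Set (EuclideanSpace ℝ (Fin p)))
  inner_cont : LowerHemicontinuousWithinAt (subdiff J) M x
  outer_cont : UpperHemicontinuousWithinAt (subdiff J) M x

/-- `J` is locally partly smooth at `x` relative to `M`: `M` is a `C²`-manifold containing `x`,
and `J` is partly smooth relative to `M` at all points of `M` near `x`. -/
def IsLocallyPartlySmoothAt {p : ℕ} (J : EuclideanSpace ℝ (Fin p) → ℝ)
    (M : Set (EuclideanSpace ℝ (Fin p))) (x : EuclideanSpace ℝ (Fin p)) : Prop :=
  x ∈ M ∧ (∀ y ∈ M, IsC2ManifoldAround M y) ∧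
    ∃ U ∈ 𝓝 x, ∀ y ∈ M ∩ U, IsPartlySmoothAt J M y

section

variable {p : ℕ}

/-- A linear functional that is maximal over `S` at a relative interior point of `S` is constant
on `S`. -/
theorem mem_orthogonal_vectorSpan_of_mem_intrinsicInterior {E : Type*} [NormedAddCommGroup E]
    [InnerProductSpace ℝ E] {S : Set E} {η d : E} (hη : η ∈ intrinsicInterior ℝ S)
    (hd : ∀ ζ ∈ S, ⟪ζ, d⟫_ℝ ≤ ⟪η, d⟫_ℝ) : d ∈ (vectorSpan ℝ S)ᗮ := by
  have hηS : η ∈ S := intrinsicInterior_subset hη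
  have key : ∀ ζ ∈ S, ⟪ζ - η, d⟫_ℝ = 0 := by
    intro ζ hζ
    obtain ⟨e, he, rfl⟩ := hη
    have hζ' : ζ ∈ affineSpan ℝ S := subset_affineSpan ℝ S hζ
    have hmem : ∀ t : ℝ, (e : E) + t • (ζ - e) ∈ affineSpan ℝ S := fun t => by
      simpa [AffineMap.lineMap_apply, add_comm] using AffineMap.lineMap_mem t e.2 hζ'
    have hc : Continuous fun t : ℝ => (⟨_, hmem t⟩ : affineSpan ℝ S) :=
      Continuous.subtype_mk (by fun_prop) _
    have he' : ((↑) : affineSpan ℝ S → E) ⁻¹' S ∈ 𝓝 (⟨_, hmem 0⟩ : affineSpan ℝ S) := by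
      simpa using mem_interior_iff_mem_nhds.1 he
    have hev : ∀ᶠ t in 𝓝 (0 : ℝ), (e : E) + t • (ζ - e) ∈ S := hc.continuousAt.preimage_mem_nhds he'
    obtain ⟨r, hr, hball⟩ := Metric.eventually_nhds_iff.1 hev
    have h1 : (e : E) + (-(r / 2)) • (ζ - e) ∈ S := hball (by
      rw [Real.dist_eq, sub_zero, abs_neg, abs_of_pos (by positivity)]; linarith)
    have h2 := hd _ h1
    rw [inner_add_left, real_inner_smul_left] at h2
    have h3 := hd ζ hζ
    rw [inner_sub_left] at h2 ⊢
    nlinarith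
  rw [vectorSpan_eq_span_vsub_set_right ℝ hηS, Submodule.mem_orthogonal]
  intro w hw
  induction hw using Submodule.span_induction with
  | mem w hw =>
    obtain ⟨ζ, hζ, rfl⟩ := hw
    exact key ζ hζ
  | zero => simp
  | add a b _ _ ha hb => rw [inner_add_left, ha, hb, add_zero]
  | smul a w _ hw => rw [real_inner_smul_left, hw, mul_zero]

/-- Along an ultrafilter, a function with values in a compact set converges in that set. -/
theorem IsCompact.exists_tendsto_ultrafilter {ι X : Type*} [TopologicalSpace X] {K : Set X}
    (hK : IsCompact K) (l : Ultrafilter ι) {f : ι → X} (hf : ∀ᶠ i in (l : Filter ι), f i ∈ K) :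
    ∃ a ∈ K, Tendsto f l (𝓝 a) :=
  hK.ultrafilter_le_nhds (l.map f) (le_principal_iff.2 hf)

/-- A limit of directions which are normal to `∂J` at points of `M` lies in the model subspace. -/
theorem mem_modelSubspace_of_tendsto {ι : Type*} {l : Filter ι} [l.NeBot]
    {J : EuclideanSpace ℝ (Fin p) → ℝ} {M : Set (EuclideanSpace ℝ (Fin p))}
    {β η₀ d₀ : EuclideanSpace ℝ (Fin p)}
    (hJ : LowerHemicontinuousWithinAt (subdiff J) M β)
    (hη₀ : η₀ ∈ intrinsicInterior ℝ (subdiff J β)) {y η d : ι → EuclideanSpace ℝ (Fin p)}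
    (hy : Tendsto y l (𝓝 β)) (hyM : ∀ᶠ i in l, y i ∈ M) (hη : Tendsto η l (𝓝 η₀))
    (hd : Tendsto d l (𝓝 d₀))
    (hle : ∀ᶠ i in l, ∀ ζ ∈ subdiff J (y i), ⟪ζ, d i⟫_ℝ ≤ ⟪η i, d i⟫_ℝ) :
    d₀ ∈ modelSubspace J β := by
  refine mem_orthogonal_vectorSpan_of_mem_intrinsicInterior hη₀ fun ζ hζ => ?_
  by_contra! hlt
  have hopen : IsOpen {q : EuclideanSpace ℝ (Fin p) × EuclideanSpace ℝ (Fin p) ×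
      EuclideanSpace ℝ (Fin p) | ⟪q.2.1, q.2.2⟫_ℝ < ⟪q.1, q.2.2⟫_ℝ} :=
    isOpen_lt (by fun_prop) (by fun_prop)
  obtain ⟨a, b, ha, hb, hζa, hηb, hab⟩ := isOpen_prod_iff.1 hopen ζ (η₀, d₀) hlt
  have h1 := (lowerHemicontinuousWithinAt_iff.1 hJ) a ha ⟨ζ, hζ, hζa⟩
  have h2 := (tendsto_nhdsWithin_iff.2 ⟨hy, hyM⟩).eventually h1
  have h3 := (hη.prodMk_nhds hd).eventually (hb.mem_nhds hηb)
  obtain ⟨i, ⟨ζ', hζ', hζa'⟩, h3, h4⟩ := (h2.and (h3.and hle)).exists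
  exact absurd (h4 ζ' hζ') (not_le.2 (hab (mk_mem_prod hζa' h3)))

/-- Limits of conormals: if `Λᵢ ∘ Aᵢ + λᵢ φᵢ = 0` with nontrivial multipliers, `Aᵢ → A` surjective
and `φᵢ → φ`, then `φ` vanishes on the kernel of `A`. -/
theorem apply_eq_zero_of_tendsto_multipliers {ι E F : Type*} [NormedAddCommGroup E]
    [NormedSpace ℝ E] [NormedAddCommGroup F] [NormedSpace ℝ F] [FiniteDimensional ℝ F]
    (l : Ultrafilter ι) {A : ι → E →L[ℝ] F} {φ : ι → E →L[ℝ] ℝ} {A₀ : E →L[ℝ] F}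
    {φ₀ : E →L[ℝ] ℝ} (hA : Tendsto A l (𝓝 A₀)) (hφ : Tendsto φ l (𝓝 φ₀))
    (hA₀ : Function.Surjective A₀)
    (h : ∀ᶠ i in (l : Filter ι), ∃ (Λ : F →L[ℝ] ℝ) (c : ℝ), (Λ, c) ≠ 0 ∧
      ∀ x, Λ (A i x) + c * φ i x = 0) {v : E} (hv : A₀ v = 0) : φ₀ v = 0 := by
  have h' : ∀ᶠ i in (l : Filter ι), ∃ q : (F →L[ℝ] ℝ) × ℝ, q ∈ Metric.sphere 0 1 ∧
      ∀ x, q.1 (A i x) + q.2 * φ i x = 0 := by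
    filter_upwards [h] with i hi
    obtain ⟨Λ, c, hne, hx⟩ := hi
    refine ⟨‖(Λ, c)‖⁻¹ • (Λ, c), ?_, fun x => ?_⟩
    · rw [mem_sphere_zero_iff_norm, norm_smul, norm_inv, norm_norm,
        inv_mul_cancel₀ (norm_ne_zero_iff.2 hne)]
    · have := congrArg (‖(Λ, c)‖⁻¹ * ·) (hx x)
      simp only [mul_zero, mul_add] at this
      simpa [mul_assoc] using this
  obtain ⟨q, hq⟩ := h'.choice
  obtain ⟨q₀, hq₀, hlim⟩ := (isCompact_sphere (0 : (F →L[ℝ] ℝ) × ℝ) 1).exists_tendsto_ultrafilter l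
    (hq.mono fun _ hi => hi.1)
  have hzero : ∀ x, q₀.1 (A₀ x) + q₀.2 * φ₀ x = 0 := by
    intro x
    have hcont : Continuous fun r : ((F →L[ℝ] ℝ) × ℝ) × (E →L[ℝ] F) × (E →L[ℝ] ℝ) =>
        r.1.1 (r.2.1 x) + r.1.2 * r.2.2 x := by fun_prop
    have h1 := (hcont.tendsto _).comp (hlim.prodMk_nhds (hA.prodMk_nhds hφ))
    refine tendsto_nhds_unique h1 (tendsto_const_nhds.congr' ?_)
    filter_upwards [hq] with i hi
    exact (hi.2 x).symm
  have hc : q₀.2 ≠ 0 := by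
    intro hc
    have h1 : q₀.1 = 0 := by
      ext w
      obtain ⟨x, rfl⟩ := hA₀ w
      simpa [hc] using hzero x
    have : q₀ = 0 := Prod.ext h1 hc
    simp [this] at hq₀
  have := hzero v
  rw [hv, map_zero, zero_add] at this
  exact (mul_eq_zero.1 this).resolve_left hc

/-- Tangent vectors of `M` are killed by the derivative of a local equation of `M`. -/
theorem fderiv_apply_eq_zero_of_mem_tangentVectors {m : ℕ} {M : Set (EuclideanSpace ℝ (Fin p))}
    {x v : EuclideanSpace ℝ (Fin p)} {F : EuclideanSpace ℝ (Fin p) → EuclideanSpace ℝ (Fin m)}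
    (hF : DifferentiableAt ℝ F x) (hM : ∀ᶠ y in 𝓝 x, (y ∈ M ↔ F y = 0))
    (hv : v ∈ tangentVectors M x) : fderiv ℝ F x v = 0 := by
  obtain ⟨γ, rfl, hγ, hd⟩ := hv
  have h1 := hF.hasFDerivAt.comp_hasDerivAt (0 : ℝ) hd
  have h2 : F ∘ γ =ᶠ[𝓝 0] fun _ => 0 := by
    filter_upwards [hγ, hd.continuousAt.eventually hM] with t ht h
    exact h.1 ht
  exact h1.unique ((hasDerivAt_const (0 : ℝ) (0 : EuclideanSpace ℝ (Fin m))).congr_of_eventuallyEq h2)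

/-- Near a point `β` around which `M` is locally the zero set of a `C²` map, points have nearest
points on `M`, close to `β`, and the residual satisfies a multiplier rule. -/
theorem exists_nearest_point {m : ℕ} {M : Set (EuclideanSpace ℝ (Fin p))}
    {β : EuclideanSpace ℝ (Fin p)} {F : EuclideanSpace ℝ (Fin p) → EuclideanSpace ℝ (Fin m)}
    (hβ : β ∈ M) (hF : ContDiffAt ℝ 2 F β) (hM : ∀ᶠ y in 𝓝 β, (y ∈ M ↔ F y = 0)) :
    ∀ᶠ x in 𝓝 β, ∃ y ∈ M, dist y β ≤ 2 * dist x β ∧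
      ∃ (Λ : EuclideanSpace ℝ (Fin m) →L[ℝ] ℝ) (c : ℝ), (Λ, c) ≠ 0 ∧
        ∀ w, Λ (fderiv ℝ F y w) + c * ⟪x - y, w⟫_ℝ = 0 := by
  have hC : ∀ᶠ y in 𝓝 β, ContDiffAt ℝ 2 F y := hF.eventually (by simp)
  obtain ⟨r, hr, hball⟩ := Metric.eventually_nhds_iff_ball.1 (hC.and hM)
  have hsub : Metric.closedBall β (r / 2) ⊆ Metric.ball β r :=
    Metric.closedBall_subset_ball (by linarith)
  have hK : IsCompact (Metric.closedBall β (r / 2) ∩ M) := by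
    have hcont : ContinuousOn F (Metric.closedBall β (r / 2)) := fun y hy =>
      (hball y (hsub hy)).1.continuousAt.continuousWithinAt
    have heq : Metric.closedBall β (r / 2) ∩ M = Metric.closedBall β (r / 2) ∩ F ⁻¹' {0} := by
      ext y
      exact and_congr_right fun hy => (hball y (hsub hy)).2
    rw [heq]
    exact (isCompact_closedBall β (r / 2)).of_isClosed_subset
      (hcont.preimage_isClosed_of_isClosed Metric.isClosed_closedBall isClosed_singleton)
      inter_subset_left
  have hβK : β ∈ Metric.closedBall β (r / 2) ∩ M :=
    ⟨Metric.mem_closedBall_self (by positivity), hβ⟩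
  filter_upwards [Metric.ball_mem_nhds β (show 0 < r / 4 by positivity)] with x hx
  obtain ⟨y, hyK, hmin⟩ := hK.exists_isMinOn ⟨β, hβK⟩
    (f := fun z => ‖x - z‖ ^ 2) (by fun_prop)
  have hxβ : dist x β < r / 4 := hx
  have hdist : dist y β ≤ 2 * dist x β := by
    have h1 : ‖x - y‖ ^ 2 ≤ ‖x - β‖ ^ 2 := hmin hβK
    have h2 : dist x y ≤ dist x β := by
      rw [dist_eq_norm, dist_eq_norm]
      exact le_of_sq_le_sq h1 (norm_nonneg _)
    linarith [dist_triangle_left y β x]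
  refine ⟨y, hyK.2, hdist, ?_⟩
  have hyball : y ∈ Metric.ball β (r / 2) := by
    rw [Metric.mem_ball]; linarith
  have hFy : F y = 0 := ((hball y (hsub hyK.1)).2).1 hyK.2
  have hext : IsLocalExtrOn (fun z => ‖x - z‖ ^ 2) {z | F z = F y} y := by
    refine Or.inl ?_
    filter_upwards [self_mem_nhdsWithin,
      mem_nhdsWithin_of_mem_nhds (Metric.isOpen_ball.mem_nhds hyball)] with z hz hzb
    have hzc := Metric.ball_subset_closedBall hzb
    exact hmin ⟨hzc, ((hball z (hsub hzc)).2).2 (hz.trans hFy)⟩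
  have hstrict : HasStrictFDerivAt F (fderiv ℝ F y) y :=
    (hball y (hsub hyK.1)).1.hasStrictFDerivAt (by simp)
  have hφ := (hasStrictFDerivAt_norm_sq (x - y)).comp y
    ((hasStrictFDerivAt_id (𝕜 := ℝ) y).const_sub x)
  obtain ⟨Λ, c, hne, hx0⟩ := hext.exists_linear_map_of_hasStrictFDerivAt hstrict hφ
  refine ⟨LinearMap.toContinuousLinearMap Λ, -2 * c, ?_, fun w => ?_⟩
  · contrapose! hne
    obtain ⟨h1, h2⟩ := Prod.mk_eq_zero.1 hne
    refine Prod.mk_eq_zero.2 ⟨?_, by linarith⟩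
    exact LinearMap.toContinuousLinearMap.map_eq_zero_iff.1 h1
  · have := hx0 w
    simp [inner_sub_left] at this ⊢
    linarith

theorem norm_inv_smul_mem_sphere {E : Type*} [NormedAddCommGroup E] [NormedSpace ℝ E] {v : E}
    (hv : v ≠ 0) : ‖v‖⁻¹ • v ∈ Metric.sphere (0 : E) 1 := by
  rw [mem_sphere_zero_iff_norm, norm_smul, norm_inv, norm_norm,
    inv_mul_cancel₀ (norm_ne_zero_iff.2 hv)]

/-- Identification of the active manifold: if `xᵢ → β` and `∂J(xᵢ) ∋ ηᵢ → η₀ ∈ ri ∂J(β)`, then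
`xᵢ` eventually lies in `M`. -/
theorem IsPartlySmoothAt.eventually_mem {ι : Type*} (l : Ultrafilter ι)
    {J : EuclideanSpace ℝ (Fin p) → ℝ} {M : Set (EuclideanSpace ℝ (Fin p))}
    {β η₀ : EuclideanSpace ℝ (Fin p)} (hJ : IsPartlySmoothAt J M β)
    (hη₀ : η₀ ∈ intrinsicInterior ℝ (subdiff J β)) {x η : ι → EuclideanSpace ℝ (Fin p)}
    (hx : Tendsto x l (𝓝 β)) (hη : Tendsto η l (𝓝 η₀))
    (hsub : ∀ᶠ i in (l : Filter ι), η i ∈ subdiff J (x i)) : ∀ᶠ i in (l : Filter ι), x i ∈ M := by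
  by_contra hcon
  have hnot : ∀ᶠ i in (l : Filter ι), x i ∉ M := Ultrafilter.eventually_not.2 hcon
  obtain ⟨hβ, m, F, hF, hsurj, hM⟩ := hJ.manifold
  obtain ⟨y, hy⟩ := (hx.eventually (exists_nearest_point hβ hF hM)).choice
  have hyM : ∀ᶠ i in (l : Filter ι), y i ∈ M := hy.mono fun _ h => h.1
  have hylim : Tendsto y l (𝓝 β) := by
    rw [tendsto_iff_dist_tendsto_zero] at hx ⊢
    refine squeeze_zero' (Eventually.of_forall fun _ => dist_nonneg) (hy.mono fun _ h => h.2.1) ?_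
    simpa using hx.const_mul 2
  have hne : ∀ᶠ i in (l : Filter ι), x i - y i ≠ 0 := by
    filter_upwards [hnot, hyM] with i h1 h2 h3
    exact h1 (sub_eq_zero.1 h3 ▸ h2)
  obtain ⟨d₀, hd₀, hd⟩ := (isCompact_sphere (0 : EuclideanSpace ℝ (Fin p)) 1).exists_tendsto_ultrafilter
    l (f := fun i => ‖x i - y i‖⁻¹ • (x i - y i)) (hne.mono fun _ h => norm_inv_smul_mem_sphere h)
  have hT : d₀ ∈ modelSubspace J β := by
    refine mem_modelSubspace_of_tendsto hJ.inner_cont hη₀ hylim hyM hη hd ?_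
    filter_upwards [hsub] with i hi ζ hζ
    have h1 := hi (y i)
    have h2 := hζ (x i)
    rw [← neg_sub (x i) (y i), inner_neg_right] at h1
    rw [real_inner_smul_right, real_inner_smul_right]
    exact mul_le_mul_of_nonneg_left (by linarith) (by positivity)
  have hker : fderiv ℝ F β d₀ = 0 :=
    fderiv_apply_eq_zero_of_mem_tangentVectors (hF.differentiableAt (by simp)) hM
      (hJ.sharp ▸ hT)
  have hlimA : Tendsto (fun i => fderiv ℝ F (y i)) l (𝓝 (fderiv ℝ F β)) :=
    ((hF.fderiv_right (m := 0) (by norm_num)).continuousAt.tendsto).comp hylim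
  have hlimφ : Tendsto (fun i => innerSL ℝ (‖x i - y i‖⁻¹ • (x i - y i))) l
      (𝓝 (innerSL ℝ d₀)) := ((innerSL ℝ).continuous.tendsto _).comp hd
  have hzero := apply_eq_zero_of_tendsto_multipliers l hlimA hlimφ hsurj (by
    filter_upwards [hy, hne] with i hi hi0
    obtain ⟨-, -, Λ, c, hΛ, hw⟩ := hi
    have hn := norm_ne_zero_iff.2 hi0
    refine ⟨Λ, c * ‖x i - y i‖, ?_, fun w => ?_⟩
    · contrapose! hΛ
      obtain ⟨h1, h2⟩ := Prod.mk_eq_zero.1 hΛ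
      exact Prod.mk_eq_zero.2 ⟨h1, (mul_eq_zero.1 h2).resolve_right hn⟩
    · rw [innerSL_apply_apply, real_inner_smul_left, mul_assoc, mul_inv_cancel_left₀ hn]
      exact hw w) hker
  rw [innerSL_apply_apply, inner_self_eq_zero] at hzero
  simp [hzero] at hd₀

theorem nonneg_of_forall_add_mul_nonneg {a c : ℝ}
    (h : ∀ t : ℝ, 0 < t → t ≤ 1 → 0 ≤ a + t * c) : 0 ≤ a := by
  have hlim : Tendsto (fun t : ℝ => a + t * c) (𝓝[>] 0) (𝓝 (a + 0 * c)) :=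
    ((by fun_prop : Continuous fun t : ℝ => a + t * c).tendsto 0).mono_left nhdsWithin_le_nhds
  rw [zero_mul, add_zero] at hlim
  refine ge_of_tendsto hlim ?_
  filter_upwards [Ioc_mem_nhdsGT (zero_lt_one' ℝ)] with t ht using h t ht.1 ht.2

theorem LinearMap.IsPositive.apply_eq_zero {E : Type*} [NormedAddCommGroup E]
    [InnerProductSpace ℝ E] {G : E →ₗ[ℝ] E} (hG : G.IsPositive) {v : E} (hv : ⟪G v, v⟫_ℝ = 0) :
    G v = 0 := by
  have h : 0 ≤ -(2 * ⟪G v, G v⟫_ℝ) := by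
    refine nonneg_of_forall_add_mul_nonneg (c := ⟪G (G v), G v⟫_ℝ) fun t ht _ => ?_
    have h1 : 0 ≤ ⟪G (v - t • G v), v - t • G v⟫_ℝ := hG.2 _
    have h2 : ⟪G (G v), v⟫_ℝ = ⟪G v, G v⟫_ℝ := hG.1 _ _
    simp only [map_sub, map_smul, inner_sub_left, inner_sub_right, real_inner_smul_left,
      real_inner_smul_right, h2, hv] at h1
    nlinarith
  have h0 := real_inner_self_nonneg (x := G v)
  exact inner_self_eq_zero.1 (le_antisymm (by linarith) h0)

/-- The opposite of the gradient of the smooth part of the objective. -/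
noncomputable def dualVector (θ : Param p) (x : EuclideanSpace ℝ (Fin p)) :
    EuclideanSpace ℝ (Fin p) :=
  (1 / θ.1) • (θ.2.1 - Matrix.toEuclideanLin θ.2.2 x)

theorem objective_sub {J : EuclideanSpace ℝ (Fin p) → ℝ} {θ : Param p}
    (hθ : θ ∈ penalizedParams p) (x x' : EuclideanSpace ℝ (Fin p)) :
    objective J θ x' - objective J θ x = J x' - J x - ⟪dualVector θ x, x' - x⟫_ℝ +
      1 / (2 * θ.1) * ⟪Matrix.toEuclideanLin θ.2.2 (x' - x), x' - x⟫_ℝ := by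
  obtain ⟨hμ, hΓ⟩ := hθ
  obtain ⟨v, rfl⟩ : ∃ v, x' = x + v := ⟨x' - x, by simp⟩
  have hsymm : ⟪Matrix.toEuclideanLin θ.2.2 x, v⟫_ℝ = ⟪Matrix.toEuclideanLin θ.2.2 v, x⟫_ℝ :=
    ((Matrix.isPositive_toEuclideanLin_iff.2 hΓ).1 x v).trans (real_inner_comm _ _)
  have hμ0 : θ.1 ≠ 0 := hμ.ne'
  simp only [objective, dualVector, add_sub_cancel_left, map_add, inner_add_left, inner_add_right,
    real_inner_smul_left, inner_sub_left, hsymm, real_inner_comm v θ.2.1]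
  field_simp
  ring

theorem quadratic_nonneg {θ : Param p} (hθ : θ ∈ penalizedParams p)
    (v : EuclideanSpace ℝ (Fin p)) :
    0 ≤ 1 / (2 * θ.1) * ⟪Matrix.toEuclideanLin θ.2.2 v, v⟫_ℝ :=
  mul_nonneg (by have := hθ.1; positivity) ((Matrix.isPositive_toEuclideanLin_iff.2 hθ.2).2 v)

theorem convexOn_objective {J : EuclideanSpace ℝ (Fin p) → ℝ} (hJ : ConvexOn ℝ univ J)
    {θ : Param p} (hθ : θ ∈ penalizedParams p) : ConvexOn ℝ univ (objective J θ) := by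
  refine ⟨convex_univ, fun x _ y _ a b ha hb hab => ?_⟩
  have h1 := objective_sub (J := J) hθ (a • x + b • y) x
  have h2 := objective_sub (J := J) hθ (a • x + b • y) y
  have h3 := hJ.2 (mem_univ x) (mem_univ y) ha hb hab
  have q1 := quadratic_nonneg hθ (x - (a • x + b • y))
  have q2 := quadratic_nonneg hθ (y - (a • x + b • y))
  have hz : ⟪dualVector θ (a • x + b • y), a • (x - (a • x + b • y)) +
      b • (y - (a • x + b • y))⟫_ℝ = 0 := by
    have : a • (x - (a • x + b • y)) + b • (y - (a • x + b • y)) = 0 := by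
      obtain rfl : b = 1 - a := by linarith
      module
    rw [this, inner_zero_right]
  rw [inner_add_right, real_inner_smul_right, real_inner_smul_right] at hz
  simp only [smul_eq_mul] at h3 ⊢
  have e1 := congrArg (a * ·) h1
  have e2 := congrArg (b * ·) h2
  have m1 := mul_nonneg ha q1
  have m2 := mul_nonneg hb q2
  simp only [mul_sub, mul_add] at e1 e2
  have f1 : a * objective J θ (a • x + b • y) + b * objective J θ (a • x + b • y)
      = objective J θ (a • x + b • y) := by rw [← add_mul, hab, one_mul]
  have f2 : a * J (a • x + b • y) + b * J (a • x + b • y) = J (a • x + b • y) := by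
    rw [← add_mul, hab, one_mul]
  linarith

theorem IsSolution.dualVector_mem_subdiff {J : EuclideanSpace ℝ (Fin p) → ℝ}
    (hJ : ConvexOn ℝ univ J) {θ : Param p} (hθ : θ ∈ penalizedParams p)
    {x : EuclideanSpace ℝ (Fin p)} (hx : IsSolution J θ x) : dualVector θ x ∈ subdiff J x := by
  intro x'
  suffices h : 0 ≤ J x' - J x - ⟪dualVector θ x, x' - x⟫_ℝ by linarith
  refine nonneg_of_forall_add_mul_nonneg
    (c := 1 / (2 * θ.1) * ⟪Matrix.toEuclideanLin θ.2.2 (x' - x), x' - x⟫_ℝ) fun t ht ht1 => ?_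
  have h1 := objective_sub (J := J) hθ x (x + t • (x' - x))
  have h2 := hx (x + t • (x' - x))
  have h3 := hJ.2 (mem_univ x) (mem_univ x') (sub_nonneg.2 ht1) ht.le (by ring)
  have h4 : (1 - t) • x + t • x' = x + t • (x' - x) := by module
  rw [h4] at h3
  simp only [add_sub_cancel_left, map_smul, real_inner_smul_left, real_inner_smul_right,
    smul_eq_mul] at h1 h3
  refine nonneg_of_mul_nonneg_right (a := t) ?_ ht
  linarith

/-- The difference of two solutions is in the kernel of `Γ` and normal to the subdifferential. -/
theorem IsSolution.sub_of_isSolution {J : EuclideanSpace ℝ (Fin p) → ℝ}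
    (hJ : ConvexOn ℝ univ J) {θ : Param p} (hθ : θ ∈ penalizedParams p)
    {x x' : EuclideanSpace ℝ (Fin p)} (hx : IsSolution J θ x) (hx' : IsSolution J θ x') :
    Matrix.toEuclideanLin θ.2.2 (x' - x) = 0 ∧
      ∀ ζ ∈ subdiff J x, ⟪ζ, x' - x⟫_ℝ ≤ ⟪dualVector θ x, x' - x⟫_ℝ := by
  have h1 := objective_sub (J := J) hθ x x'
  rw [le_antisymm (hx' x) (hx x'), sub_self] at h1
  have h2 := quadratic_nonneg hθ (x' - x)
  have h3 := hx.dualVector_mem_subdiff hJ hθ x'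
  refine ⟨(Matrix.isPositive_toEuclideanLin_iff.2 hθ.2).apply_eq_zero ?_, fun ζ hζ => ?_⟩
  · have h4 : 1 / (2 * θ.1) * ⟪Matrix.toEuclideanLin θ.2.2 (x' - x), x' - x⟫_ℝ = 0 := by linarith
    exact (mul_eq_zero.1 h4).resolve_left (by have := hθ.1; positivity)
  · have := hζ x'
    linarith

theorem continuous_toEuclideanLin_apply :
    Continuous fun q : Matrix (Fin p) (Fin p) ℝ × EuclideanSpace ℝ (Fin p) =>
      Matrix.toEuclideanLin q.1 q.2 := by
  simp only [Matrix.toEuclideanLin, Matrix.toLpLin_apply]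
  exact (PiLp.continuous_toLp 2 _).comp
    (continuous_fst.matrix_mulVec ((PiLp.continuous_ofLp 2 _).comp continuous_snd))

theorem tendsto_dualVector {ι : Type*} {l : Filter ι} {θ : Param p} {x : EuclideanSpace ℝ (Fin p)}
    (hθ : θ ∈ penalizedParams p) {f : ι → Param p} {g : ι → EuclideanSpace ℝ (Fin p)}
    (hf : Tendsto f l (𝓝 θ)) (hg : Tendsto g l (𝓝 x)) :
    Tendsto (fun i => dualVector (f i) (g i)) l (𝓝 (dualVector θ x)) := by
  obtain ⟨μ, u, Γ⟩ := θ
  have hμ : Tendsto (fun i => (f i).1) l (𝓝 μ) := hf.fst_nhds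
  have hu : Tendsto (fun i => (f i).2.1) l (𝓝 u) := hf.snd_nhds.fst_nhds
  have hΓ : Tendsto (fun i => (f i).2.2) l (𝓝 Γ) := hf.snd_nhds.snd_nhds
  have hΓx : Tendsto (fun i => Matrix.toEuclideanLin (f i).2.2 (g i)) l
      (𝓝 (Matrix.toEuclideanLin Γ x)) := by
    have h := (continuous_toEuclideanLin_apply.tendsto (Γ, x)).comp (hΓ.prodMk_nhds hg)
    exact h
  have hinv : Tendsto (fun i => 1 / (f i).1) l (𝓝 (1 / μ)) := tendsto_const_nhds.div hμ hθ.1.ne'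
  exact hinv.smul (hu.sub hΓx)

/-- A convex function whose values on a sphere exceed its value at the center has a minimizer, and
all its minimizers are in the ball. -/
theorem ConvexOn.exists_forall_le_of_sphere {E : Type*} [NormedAddCommGroup E] [NormedSpace ℝ E]
    [FiniteDimensional ℝ E] {f : E → ℝ} (hf : ConvexOn ℝ univ f) {β : E} {ε : ℝ} (hε : 0 < ε)
    (hS : ∀ x ∈ Metric.sphere β ε, f β < f x) :
    (∃ x, ∀ y, f x ≤ f y) ∧ ∀ x, (∀ y, f x ≤ f y) → dist x β ≤ ε := by
  have hout : ∀ x, ε < dist x β → f β < f x := by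
    intro x hx
    rw [dist_eq_norm] at hx
    have hn : 0 < ‖x - β‖ := hε.trans hx
    set t := ε / ‖x - β‖ with ht
    have ht0 : 0 < t := by positivity
    have ht1 : t ≤ 1 := (div_le_one hn).2 hx.le
    have hz : β + t • (x - β) ∈ Metric.sphere β ε := by
      rw [mem_sphere_iff_norm, add_sub_cancel_left, norm_smul, Real.norm_of_nonneg ht0.le, ht,
        div_mul_cancel₀ _ hn.ne']
    have h1 := hS _ hz
    have h2 := hf.2 (mem_univ β) (mem_univ x) (sub_nonneg.2 ht1) ht0.le (by ring)
    have h3 : (1 - t) • β + t • x = β + t • (x - β) := by module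
    rw [h3] at h2
    simp only [smul_eq_mul] at h2
    nlinarith
  have : ProperSpace E := FiniteDimensional.proper_real E
  obtain ⟨x, -, hmin⟩ := (isCompact_closedBall β ε).exists_isMinOn
    ⟨β, Metric.mem_closedBall_self hε.le⟩ ((hf.continuousOn isOpen_univ).mono (subset_univ _))
  refine ⟨⟨x, fun y => ?_⟩, fun x hx => ?_⟩
  · by_cases hy : y ∈ Metric.closedBall β ε
    · exact hmin hy
    · exact (hmin (Metric.mem_closedBall_self hε.le)).trans
        (hout y (not_le.1 (mt Metric.mem_closedBall.2 hy))).le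
  · exact not_lt.1 fun h => absurd (hx β) (not_le.2 (hout x h))

/-- Stability of an isolated solution: nearby problems have solutions, all of which are close. -/
theorem eventually_exists_isSolution {J : EuclideanSpace ℝ (Fin p) → ℝ} (hJ : ConvexOn ℝ univ J)
    {θ : Param p} (hθ : θ ∈ penalizedParams p) {β : EuclideanSpace ℝ (Fin p)}
    (hβ : IsSolution J θ β) (huniq : ∀ x, IsSolution J θ x → x = β) {ε : ℝ} (hε : 0 < ε) :
    ∀ᶠ θ' in 𝓝[penalizedParams p] θ,
      (∃ x, IsSolution J θ' x) ∧ ∀ x, IsSolution J θ' x → dist x β ≤ ε := by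
  have hJc : Continuous J := hJ.locallyLipschitz.continuous
  have hpos : ∀ᶠ θ' in 𝓝 θ, ∀ x ∈ Metric.sphere β ε,
      0 < J x - J β - ⟪dualVector θ' β, x - β⟫_ℝ +
        1 / (2 * θ'.1) * ⟪Matrix.toEuclideanLin θ'.2.2 (x - β), x - β⟫_ℝ := by
    refine (isCompact_sphere β ε).eventually_forall_of_forall_eventually fun x hx => ?_
    have hcont : ContinuousAt (fun q : Param p × EuclideanSpace ℝ (Fin p) =>
        J q.2 - J β - ⟪dualVector q.1 β, q.2 - β⟫_ℝ +
          1 / (2 * q.1.1) * ⟪Matrix.toEuclideanLin q.1.2.2 (q.2 - β), q.2 - β⟫_ℝ) (θ, x) := by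
      have h1 : ContinuousAt (fun q : Param p × EuclideanSpace ℝ (Fin p) =>
          dualVector q.1 β) (θ, x) :=
        tendsto_dualVector hθ (by fun_prop : Continuous fun q :
          Param p × EuclideanSpace ℝ (Fin p) => q.1).continuousAt tendsto_const_nhds
      have h2 : Continuous fun q : Param p × EuclideanSpace ℝ (Fin p) =>
          Matrix.toEuclideanLin q.1.2.2 (q.2 - β) :=
        continuous_toEuclideanLin_apply.comp (by fun_prop :
          Continuous fun q : Param p × EuclideanSpace ℝ (Fin p) => (q.1.2.2, q.2 - β))
      have h3 : ContinuousAt (fun q : Param p × EuclideanSpace ℝ (Fin p) =>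
          1 / (2 * q.1.1)) (θ, x) :=
        continuousAt_const.div (by fun_prop) (mul_ne_zero two_ne_zero hθ.1.ne')
      have h4 : ContinuousAt (fun q : Param p × EuclideanSpace ℝ (Fin p) => q.2 - β) (θ, x) := by
        fun_prop
      exact ((by fun_prop : Continuous fun q : Param p × EuclideanSpace ℝ (Fin p) =>
        J q.2 - J β).continuousAt.sub (h1.inner h4)).add (h3.mul (h2.continuousAt.inner h4))
    refine hcont.eventually_const_lt ?_
    have hlt : objective J θ β < objective J θ x := by
      refine lt_of_le_of_ne (hβ x) fun heq => ?_
      have := huniq x fun y => heq ▸ hβ y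
      rw [this, Metric.mem_sphere, dist_self] at hx
      exact hε.ne hx
    exact (sub_pos.2 hlt).trans_eq (objective_sub hθ β x)
  filter_upwards [nhdsWithin_le_nhds hpos, self_mem_nhdsWithin] with θ' h hθ'
  refine (convexOn_objective hJ hθ').exists_forall_le_of_sphere hε fun x hx => ?_
  have := h x hx
  rw [← objective_sub hθ' β x] at this
  exact sub_pos.1 this

end

theorem theorem4 (p : ℕ) (J : EuclideanSpace ℝ (Fin p) → ℝ) (hJ : ConvexOn ℝ Set.univ J)
    (M : Set (EuclideanSpace ℝ (Fin p)))
    (μ : ℝ) (u : EuclideanSpace ℝ (Fin p)) (Γ : Matrix (Fin p) (Fin p) ℝ)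
    (hμ : 0 < μ) (hΓ : Γ.PosSemidef)
    (β : EuclideanSpace ℝ (Fin p)) (hβ : IsSolution J (μ, u, Γ) β)
    (hM : IsLocallyPartlySmoothAt J M β)
    (hinj : LinearMap.ker (Matrix.toEuclideanLin Γ) ⊓ modelSubspace J β = ⊥)
    (hri : (1 / μ) • (u - Matrix.toEuclideanLin Γ β) ∈ intrinsicInterior ℝ (subdiff J β)) :
    ∀ᶠ θ' in 𝓝[penalizedParams p] (μ, u, Γ),
      ∃ β' : EuclideanSpace ℝ (Fin p),
        IsSolution J θ' β' ∧ (∀ β'', IsSolution J θ' β'' → β'' = β') ∧ β' ∈ M := by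
  have hθ : (μ, u, Γ) ∈ penalizedParams p := ⟨hμ, hΓ⟩
  obtain ⟨hβM, -, U, hU, hloc⟩ := hM
  have hps : IsPartlySmoothAt J M β := hloc β ⟨hβM, mem_of_mem_nhds hU⟩
  have hdegen : ∀ v, Matrix.toEuclideanLin Γ v = 0 → v ∈ modelSubspace J β → v = 0 :=
    fun v h1 h2 => (Submodule.mem_bot ℝ).1 (hinj ▸ Submodule.mem_inf.2 ⟨h1, h2⟩)
  have huniq : ∀ x, IsSolution J (μ, u, Γ) x → x = β := by
    intro x hx
    obtain ⟨h1, h2⟩ := hβ.sub_of_isSolution hJ hθ hx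
    exact sub_eq_zero.1
      (hdegen _ h1 (mem_orthogonal_vectorSpan_of_mem_intrinsicInterior hri h2))
  by_contra hcon
  have hfreq := not_eventually.1 hcon
  have : (𝓝[penalizedParams p] (μ, u, Γ) ⊓ 𝓟 {θ' | ¬∃ β' : EuclideanSpace ℝ (Fin p),
      IsSolution J θ' β' ∧ (∀ β'', IsSolution J θ' β'' → β'' = β') ∧ β' ∈ M}).NeBot :=
    frequently_iff_neBot.1 hfreq
  obtain ⟨l, hl⟩ := Ultrafilter.exists_le (𝓝[penalizedParams p] (μ, u, Γ) ⊓
    𝓟 {θ' | ¬∃ β' : EuclideanSpace ℝ (Fin p),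
      IsSolution J θ' β' ∧ (∀ β'', IsSolution J θ' β'' → β'' = β') ∧ β' ∈ M})
  have hln : (l : Filter (Param p)) ≤ 𝓝[penalizedParams p] (μ, u, Γ) := hl.trans inf_le_left
  have hlθ : Tendsto id (l : Filter (Param p)) (𝓝 (μ, u, Γ)) := hln.trans nhdsWithin_le_nhds
  have hbad := le_principal_iff.1 (hl.trans inf_le_right)
  have hpen : ∀ᶠ θ' in (l : Filter (Param p)), θ' ∈ penalizedParams p := hln self_mem_nhdsWithin
  have hstab : ∀ ε > 0, ∀ᶠ θ' in (l : Filter (Param p)),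
      (∃ x, IsSolution J θ' x) ∧ ∀ x, IsSolution J θ' x → dist x β ≤ ε :=
    fun ε hε => hln (eventually_exists_isSolution hJ hθ hβ huniq hε)
  have hlim : ∀ x : Param p → EuclideanSpace ℝ (Fin p),
      (∀ᶠ θ' in (l : Filter (Param p)), IsSolution J θ' (x θ')) →
      Tendsto x l (𝓝 β) ∧ Tendsto (fun θ' => dualVector θ' (x θ')) l
        (𝓝 ((1 / μ) • (u - Matrix.toEuclideanLin Γ β))) ∧
      ∀ᶠ θ' in (l : Filter (Param p)), x θ' ∈ M := by
    intro x hx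
    have h1 : Tendsto x l (𝓝 β) := by
      refine Metric.tendsto_nhds.2 fun ε hε => ?_
      filter_upwards [hx, hstab (ε / 2) (by positivity)] with θ' h1 h2
      exact (h2.2 _ h1).trans_lt (by linarith)
    have h2 := tendsto_dualVector hθ hlθ h1
    refine ⟨h1, h2, hps.eventually_mem l hri h1 h2 ?_⟩
    filter_upwards [hx, hpen] with θ' h1 h2 using h1.dualVector_mem_subdiff hJ h2
  obtain ⟨x, hx⟩ := ((hstab 1 one_pos).mono fun _ h => h.1).choice
  obtain ⟨hxβ, hxη, hxM⟩ := hlim x hx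
  have hother : ∀ᶠ θ' in (l : Filter (Param p)), ∃ x', IsSolution J θ' x' ∧ x' ≠ x θ' := by
    filter_upwards [hbad, hx, hxM] with θ' h1 h2 h3
    by_contra! h4
    exact h1 ⟨x θ', h2, h4, h3⟩
  obtain ⟨x', hx'⟩ := hother.choice
  have hne : ∀ᶠ θ' in (l : Filter (Param p)), x' θ' - x θ' ≠ 0 :=
    hx'.mono fun _ h => sub_ne_zero.2 h.2
  obtain ⟨d₀, hd₀, hd⟩ :=
    (isCompact_sphere (0 : EuclideanSpace ℝ (Fin p)) 1).exists_tendsto_ultrafilter l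
      (f := fun θ' => ‖x' θ' - x θ'‖⁻¹ • (x' θ' - x θ'))
      (hne.mono fun _ h => norm_inv_smul_mem_sphere h)
  have hdiff : ∀ᶠ θ' in (l : Filter (Param p)),
      Matrix.toEuclideanLin θ'.2.2 (x' θ' - x θ') = 0 ∧
        ∀ ζ ∈ subdiff J (x θ'), ⟪ζ, x' θ' - x θ'⟫_ℝ ≤ ⟪dualVector θ' (x θ'), x' θ' - x θ'⟫_ℝ := by
    filter_upwards [hx, hx', hpen] with θ' h1 h2 h3 using h1.sub_of_isSolution hJ h3 h2.1
  have hT : d₀ ∈ modelSubspace J β := by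
    refine mem_modelSubspace_of_tendsto hps.inner_cont hri hxβ hxM hxη hd ?_
    filter_upwards [hdiff] with θ' h ζ hζ
    rw [real_inner_smul_right, real_inner_smul_right]
    exact mul_le_mul_of_nonneg_left (h.2 ζ hζ) (by positivity)
  have hker : Matrix.toEuclideanLin Γ d₀ = 0 := by
    have hΓlim : Tendsto (fun θ' : Param p => θ'.2.2) l (𝓝 Γ) :=
      ((by fun_prop : Continuous fun θ' : Param p => θ'.2.2).tendsto (μ, u, Γ)).comp hlθ
    have h1 := (continuous_toEuclideanLin_apply.tendsto (Γ, d₀)).comp (hΓlim.prodMk_nhds hd)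
    refine tendsto_nhds_unique h1 (tendsto_const_nhds.congr' ?_)
    filter_upwards [hdiff] with θ' h
    simp only [Function.comp_apply, map_smul, h.1, smul_zero]
  have hzero := hdegen d₀ hker hT
  simp [hzero] at hd₀
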